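/- Let $F$ be an algebraically closed field of characteristic $0$. For $\alpha\in F$ and an integer $s\ge 1$ let $J(\alpha,s)$ denote the $s\times s$ Jordan block with $\alpha$ on the diagonal, $1$ on the superdiagonal and $0$ elsewhere. Let $\alpha_1,\dots,\alpha_t\in F$ be nonzero and let $0<r_1\le r_2\le\cdots\le r_t$ be integers. Put $\alpha=\prod_{i=1}^t\alpha_i$ and $n=\sum_{j=1}^t r_j-t$, define integers $c_0,\dots,c_n$ by $$\prod_{j=1}^t\bigl(1+x+\cdots+x^{r_j-1}\bigr)=\sum_{k=0}^n c_kx^k,$$ and set $c_{-1}=0$. Then $c_k-c_{k-1}\ge 0$ for $0\le k\le\lfloor n/2\rfloor$, and the Jordan canonical form (unique up to the order of the blocks) of the tensor (Kronecker) product $J(\alpha_1,r_1)\otimes J(\alpha_2,r_2)\otimes\cdots\otimes J(\alpha_t,r_t)$ is $$\bigoplus_{k=0}^{\lfloor n/2\rfloor}J(\alpha,\,n+1-2k)^{\oplus(c_k-c_{k-1})}.$$ -/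

import Mathlib

/-- The Jordan block `J(a, s)`: `a` on the diagonal, `1` on the superdiagonal, `0` elsewhere. -/
def jordanBlock {K : Type*} [Field K] (a : K) (s : ℕ) : Matrix (Fin s) (Fin s) K :=
  Matrix.of fun i j => if i = j then a else if (i : ℕ) + 1 = (j : ℕ) then 1 else 0

/-- The tensor (Kronecker) product of a finite family of square matrices: its rows and columns are
indexed by tuples, and the entry at `(x, y)` is the product of the entries at `(x j, y j)`. -/
def tensorMatrix {K : Type*} [Field K] {t : ℕ} {r : Fin t → ℕ}
    (A : (j : Fin t) → Matrix (Fin (r j)) (Fin (r j)) K) :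
    Matrix ((j : Fin t) → Fin (r j)) ((j : Fin t) → Fin (r j)) K :=
  Matrix.of fun x y => ∏ j, A j (x j) (y j)

/-- `IsJordanForm A S`: the Jordan canonical form of the square matrix `A` is the direct sum of the
Jordan blocks `J(a, s)`, `(a, s)` running through the multiset `S`. That is, all `s` are positive
and, for an enumeration `b` of `S`, the matrix `A` is similar to the block diagonal matrix with
blocks `J(a, s)`; the bijection `e` only renames the rows and columns. -/
def IsJordanForm {K : Type*} [Field K] {ι : Type*} [Fintype ι] [DecidableEq ι]
    (A : Matrix ι ι K) (S : Multiset (K × ℕ)) : Prop :=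
  ∃ (m : ℕ) (b : Fin m → K × ℕ),
    Finset.univ.val.map b = S ∧ (∀ i, 0 < (b i).2) ∧
    ∃ (e : ι ≃ (i : Fin m) × Fin (b i).2) (P : (Matrix ι ι K)ˣ),
      (P : Matrix ι ι K) * A * ((P⁻¹ : (Matrix ι ι K)ˣ) : Matrix ι ι K) =
        (Matrix.blockDiagonal' fun i => jordanBlock (b i).1 (b i).2).submatrix e e

/-- The coefficient `c_k` of `x ^ k` in `∏ j, (1 + x + ⋯ + x ^ (r j - 1))`, for any integer `k`;
it is `0` for negative `k`. -/
noncomputable def blockCoeff {t : ℕ} (r : Fin t → ℕ) (k : ℤ) : ℤ :=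
  if 0 ≤ k then
    (∏ j, ∑ i ∈ Finset.range (r j), (Polynomial.X : Polynomial ℤ) ^ i).coeff k.toNat
  else 0

/-!
Over a field of characteristic zero, `J(α, s)` with `α ≠ 0` is similar to `α • exp N` for the
nilpotent Jordan block `N = J(0, s)`, because `α • (exp N - 1)` is `N` times a unit commuting with
`N`. Hence `J(α₁, r₁) ⊗ ⋯ ⊗ J(αₜ, rₜ)` is similar to `α • exp L`, where
`L = ∑ j, 1 ⊗ ⋯ ⊗ J(0, rⱼ) ⊗ ⋯ ⊗ 1`, and its Jordan form is determined by the ranks of the powers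
of `L`. Now `L` is the raising operator of a tensor product of irreducible representations of `sl₂`,
in which the basis vector at `(x₁, …, xₜ)` has weight `n - 2 ∑ xⱼ`, so that weight `n - 2k` has
multiplicity `c_k`. As `L ^ i` is injective on weight `w` when `w + i ≤ 0`, its rank can be read off
from the weight multiplicities. The number of blocks of size `s + 1` is the second difference of the
ranks, which is the multiplicity of weight `s` minus that of weight `s + 2`.
-/

open Module Polynomial Finset
open scoped Matrix

section Rank

variable {K : Type*} [Field K]

theorem blockDiagonal'_mulVec_apply {κ : Type*} [Fintype κ] [DecidableEq κ] {m : κ → Type*}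
    [∀ i, Fintype (m i)] (A : ∀ i, Matrix (m i) (m i) K) (v : (Σ i, m i) → K) (i : κ) (x : m i) :
    (Matrix.blockDiagonal' A *ᵥ v) ⟨i, x⟩ = (A i *ᵥ fun y => v ⟨i, y⟩) x := by
  simp only [Matrix.mulVec, dotProduct, Fintype.sum_sigma]
  rw [Fintype.sum_eq_single i fun j hj => Finset.sum_eq_zero fun y _ => by
    rw [Matrix.blockDiagonal'_apply_ne _ _ _ hj.symm, zero_mul]]
  simp only [Matrix.blockDiagonal'_apply_eq]

theorem rank_add_finrank_ker_mulVecLin {ι : Type*} [Fintype ι] (A : Matrix ι ι K) :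
    A.rank + finrank K (LinearMap.ker A.mulVecLin) = Fintype.card ι :=
  A.mulVecLin.finrank_range_add_finrank_ker.trans (finrank_fintype_fun_eq_card K)

theorem eq_zero_of_rank_eq_zero {ι : Type*} [Fintype ι] {A : Matrix ι ι K} (hA : A.rank = 0) :
    A = 0 := by
  classical
  exact Matrix.toLin'.map_eq_zero_iff.1
    (LinearMap.range_eq_bot.1 (Submodule.finrank_eq_zero.1 hA))

theorem rank_blockDiagonal' {κ : Type*} [Fintype κ] [DecidableEq κ] {m : κ → Type*}
    [∀ i, Fintype (m i)] (A : ∀ i, Matrix (m i) (m i) K) :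
    (Matrix.blockDiagonal' A).rank = ∑ i, (A i).rank := by
  let kerEquiv : LinearMap.ker (Matrix.blockDiagonal' A).mulVecLin ≃ₗ[K]
      ∀ i, LinearMap.ker (A i).mulVecLin :=
    { toFun := fun v i => ⟨fun y => v.1 ⟨i, y⟩, funext fun x =>
        (blockDiagonal'_mulVec_apply A v.1 i x).symm.trans (congrFun v.2 ⟨i, x⟩)⟩
      map_add' := fun _ _ => rfl
      map_smul' := fun _ _ => rfl
      invFun := fun g => ⟨fun x => (g x.1).1 x.2, funext fun x =>
        (blockDiagonal'_mulVec_apply A _ x.1 x.2).trans (congrFun (g x.1).2 x.2)⟩ }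
  have hker := kerEquiv.finrank_eq.trans (finrank_pi_fintype K)
  have hcard := rank_add_finrank_ker_mulVecLin (Matrix.blockDiagonal' A)
  rw [hker, Fintype.card_sigma,
    ← Finset.sum_congr rfl fun i _ => rank_add_finrank_ker_mulVecLin (A i),
    Finset.sum_add_distrib] at hcard
  exact Nat.add_right_cancel hcard

end Rank

section JordanBlock

variable {K : Type*} [Field K] {s : ℕ}

theorem jordanBlock_zero_apply (x y : Fin s) :
    jordanBlock (0 : K) s x y = if (x : ℕ) + 1 = y then 1 else 0 := by
  by_cases h : x = y <;> simp [jordanBlock, h]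

theorem jordanBlock_eq_add_smul_one (a : K) (s : ℕ) :
    jordanBlock a s = jordanBlock 0 s + a • 1 := by
  ext x y
  by_cases h : x = y <;> simp [jordanBlock, h]

theorem jordanBlock_sub_smul_one (a b : K) (s : ℕ) :
    jordanBlock a s - b • (1 : Matrix (Fin s) (Fin s) K) = jordanBlock (a - b) s := by
  rw [jordanBlock_eq_add_smul_one a, jordanBlock_eq_add_smul_one (a - b), sub_smul, add_sub_assoc]

theorem jordanBlock_zero_mul_apply (M : Matrix (Fin s) (Fin s) K) (x y : Fin s) :
    (jordanBlock (0 : K) s * M) x y = if h : (x : ℕ) + 1 < s then M ⟨x + 1, h⟩ y else 0 := by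
  simp only [Matrix.mul_apply, jordanBlock_zero_apply, ite_mul, one_mul, zero_mul]
  split_ifs with h
  · rw [Fintype.sum_eq_single ⟨x + 1, h⟩ fun z hz => if_neg fun hxz => hz (Fin.ext hxz.symm),
      if_pos rfl]
  · exact Finset.sum_eq_zero fun z _ => if_neg (by omega)

theorem mul_jordanBlock_zero_apply (M : Matrix (Fin s) (Fin s) K) (x y : Fin s) :
    (M * jordanBlock (0 : K) s) x y = if 0 < (y : ℕ) then M x ⟨y - 1, by omega⟩ else 0 := by
  simp only [Matrix.mul_apply, jordanBlock_zero_apply, mul_ite, mul_one, mul_zero]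
  split_ifs with h
  · rw [Fintype.sum_eq_single ⟨y - 1, by omega⟩ fun z hz => if_neg fun hzy => hz
      (Fin.ext (by simp only; omega)), if_pos (by simp only; omega)]
  · exact Finset.sum_eq_zero fun z _ => if_neg (by omega)

theorem jordanBlock_zero_pow_apply (i : ℕ) (x y : Fin s) :
    (jordanBlock (0 : K) s ^ i) x y = if (x : ℕ) + i = y then 1 else 0 := by
  induction i generalizing x with
  | zero => simp [Matrix.one_apply, Fin.ext_iff]
  | succ i ih =>
    rw [pow_succ', jordanBlock_zero_mul_apply]
    by_cases h : (x : ℕ) + 1 < s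
    · rw [dif_pos h, ih, Nat.add_right_comm, add_assoc]
    · rw [dif_neg h, if_neg (by omega)]

variable (K) in
theorem rank_jordanBlock_zero_pow (s i : ℕ) : (jordanBlock (0 : K) s ^ i).rank = s - i := by
  apply le_antisymm
  · have hrows : Function.support (jordanBlock (0 : K) s ^ i).row ⊆
        ({x | (x : ℕ) < s - i} : Finset (Fin s)) := by
      refine Function.support_subset_iff'.2 fun x hx => funext fun y => ?_
      have hxi : ¬ (x : ℕ) < s - i := by simpa using hx
      exact (jordanBlock_zero_pow_apply i x y).trans (if_neg (by omega))
    simpa [Fin.card_filter_val_lt] using Matrix.rank_le_card_of_support_subset _ _ hrows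
  · have hminor : (jordanBlock (0 : K) s ^ i).submatrix (fun x : Fin (s - i) => ⟨x, by omega⟩)
        (fun y : Fin (s - i) => ⟨y + i, by omega⟩) = 1 := by
      ext x y
      simp [jordanBlock_zero_pow_apply, Matrix.one_apply, Fin.ext_iff]
    calc s - i = (1 : Matrix (Fin (s - i)) (Fin (s - i)) K).rank := by
          rw [Matrix.rank_one, Fintype.card_fin]
      _ ≤ (jordanBlock (0 : K) s ^ i).rank := hminor ▸ Matrix.rank_submatrix_le _ _ _

theorem isUnit_add_smul_one_of_isNilpotent {R : Type*} [Ring R] [Algebra K R] {M : R}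
    (hM : IsNilpotent M) {c : K} (hc : c ≠ 0) : IsUnit (M + c • (1 : R)) := by
  rw [← Algebra.algebraMap_eq_smul_one]
  exact hM.isUnit_add_right_of_commute ((isUnit_iff_ne_zero.2 hc).map _)
    (Algebra.commutes c M).symm

theorem jordanBlock_zero_pow_eq_zero {i : ℕ} (hi : s ≤ i) : jordanBlock (0 : K) s ^ i = 0 := by
  ext x y
  exact (jordanBlock_zero_pow_apply i x y).trans (if_neg (by omega))

variable (K) in
theorem isNilpotent_jordanBlock_zero (s : ℕ) : IsNilpotent (jordanBlock (0 : K) s) :=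
  ⟨s, jordanBlock_zero_pow_eq_zero le_rfl⟩

theorem isUnit_jordanBlock {a : K} (ha : a ≠ 0) (s : ℕ) : IsUnit (jordanBlock a s) := by
  rw [jordanBlock_eq_add_smul_one]
  exact isUnit_add_smul_one_of_isNilpotent (isNilpotent_jordanBlock_zero K s) ha

theorem rank_jordanBlock_sub_pow [DecidableEq K] (a b : K) (s i : ℕ) :
    ((jordanBlock a s - b • (1 : Matrix (Fin s) (Fin s) K)) ^ i).rank =
      if a = b then s - i else s := by
  rw [jordanBlock_sub_smul_one]
  split_ifs with h
  · rw [h, sub_self, rank_jordanBlock_zero_pow]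
  · rw [Matrix.rank_of_isUnit _ ((isUnit_jordanBlock (sub_ne_zero.2 h) s).pow i), Fintype.card_fin]

end JordanBlock

section Multiplicity

variable {K : Type*} [Field K] {ι : Type*} [Fintype ι] [DecidableEq ι] {A : Matrix ι ι K}
  {S : Multiset (K × ℕ)}

theorem rank_eq_of_isConj {B : Matrix ι ι K} (h : IsConj A B) : A.rank = B.rank := by
  obtain ⟨P, hP⟩ := h
  rw [← Matrix.rank_mul_eq_right_of_isUnit_det _ A ((Matrix.isUnit_iff_isUnit_det _).1 P.isUnit),
    hP.eq, Matrix.rank_mul_eq_left_of_isUnit_det _ B ((Matrix.isUnit_iff_isUnit_det _).1 P.isUnit)]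

theorem rank_sub_smul_one_pow_eq_of_isConj {B : Matrix ι ι K} (h : IsConj A B) (b : K) (i : ℕ) :
    ((A - b • (1 : Matrix ι ι K)) ^ i).rank = ((B - b • (1 : Matrix ι ι K)) ^ i).rank := by
  obtain ⟨P, hP⟩ := h
  have hscalar : SemiconjBy (P : Matrix ι ι K) (b • 1) (b • 1) :=
    (Commute.one_right _).smul_right b
  exact rank_eq_of_isConj ⟨P, (hP.sub_right hscalar).pow_right i⟩

theorem rank_submatrix_sub_smul_one_pow {κ : Type*} [Fintype κ] [DecidableEq κ]
    (D : Matrix κ κ K) (e : ι ≃ κ) (b : K) (i : ℕ) :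
    ((D.submatrix e e - b • 1) ^ i).rank = ((D - b • 1) ^ i).rank := by
  have hreindex : (D.submatrix e e - b • 1) ^ i =
      Matrix.reindexAlgEquiv K K e.symm ((D - b • 1) ^ i) := by
    rw [map_pow, map_sub, map_smul, map_one]
    rfl
  rw [hreindex, Matrix.coe_reindexAlgEquiv, Matrix.rank_reindex]

theorem IsJordanForm.rank_sub_pow [DecidableEq K] (h : IsJordanForm A S) (b : K) (i : ℕ) :
    ((A - b • (1 : Matrix ι ι K)) ^ i).rank =
      (S.map fun q => if q.1 = b then q.2 - i else q.2).sum := by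
  obtain ⟨m, c, rfl, -, e, P, hP⟩ := h
  have hblocks : (Matrix.blockDiagonal' fun j => jordanBlock (c j).1 (c j).2) - b • 1 =
      Matrix.blockDiagonal' fun j => jordanBlock (c j).1 (c j).2 - b • 1 := by
    rw [← Matrix.blockDiagonal'_one, ← Matrix.blockDiagonal'_smul, ← Matrix.blockDiagonal'_sub]
    rfl
  rw [rank_sub_smul_one_pow_eq_of_isConj ⟨P, (Units.mul_inv_eq_iff_eq_mul P).1 hP⟩,
    rank_submatrix_sub_smul_one_pow, hblocks, ← Matrix.blockDiagonal'_pow, rank_blockDiagonal',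
    Multiset.map_map]
  exact Finset.sum_congr rfl fun j _ => rank_jordanBlock_sub_pow _ _ _ _

theorem count_add_two_mul_sum_sub {κ : Type*} [DecidableEq κ] (S : Multiset (κ × ℕ)) (b : κ)
    (s : ℕ) :
    S.count (b, s + 1) + 2 * (S.map fun q => if q.1 = b then q.2 - (s + 1) else q.2).sum =
      (S.map fun q => if q.1 = b then q.2 - s else q.2).sum +
        (S.map fun q => if q.1 = b then q.2 - (s + 2) else q.2).sum := by
  induction S using Multiset.induction with
  | empty => simp
  | cons q S ih =>
    obtain ⟨a, u⟩ := q
    simp only [Multiset.map_cons, Multiset.sum_cons, Multiset.count_cons, Prod.mk.injEq]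
    by_cases hab : a = b
    · subst hab
      simp only [true_and, if_true]
      split_ifs <;> omega
    · simp only [if_neg hab, if_neg (fun h : b = a ∧ s + 1 = u => hab h.1.symm)]
      omega

theorem IsJordanForm.count_add_two_mul_rank [DecidableEq K] (h : IsJordanForm A S) (b : K)
    (s : ℕ) :
    S.count (b, s + 1) + 2 * ((A - b • (1 : Matrix ι ι K)) ^ (s + 1)).rank =
      ((A - b • (1 : Matrix ι ι K)) ^ s).rank + ((A - b • (1 : Matrix ι ι K)) ^ (s + 2)).rank := by
  simp only [h.rank_sub_pow, count_add_two_mul_sum_sub]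

theorem IsJordanForm.snd_pos (h : IsJordanForm A S) {q : K × ℕ} (hq : q ∈ S) : 0 < q.2 := by
  obtain ⟨m, c, rfl, hpos, -⟩ := h
  obtain ⟨i, -, rfl⟩ := Multiset.mem_map.1 hq
  exact hpos i

theorem IsJordanForm.fst_eq (h : IsJordanForm A S) {a : K}
    (hA : IsNilpotent (A - a • (1 : Matrix ι ι K))) {q : K × ℕ} (hq : q ∈ S) : q.1 = a := by
  classical
  by_contra hne
  have hunit : IsUnit (A - q.1 • (1 : Matrix ι ι K)) := by
    simpa [sub_smul] using isUnit_add_smul_one_of_isNilpotent hA (sub_ne_zero.2 (Ne.symm hne))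
  obtain ⟨s, hs⟩ := Nat.exists_eq_add_of_lt (h.snd_pos hq)
  rw [zero_add] at hs
  have hcount := h.count_add_two_mul_rank q.1 s
  simp only [Matrix.rank_of_isUnit _ (hunit.pow _)] at hcount
  have hmem : 0 < S.count (q.1, s + 1) := Multiset.count_pos.2 (hs ▸ hq)
  omega

end Multiplicity

section Existence

variable {K : Type*} [Field K]

/-- The basis of `K[X] / (X ^ s)` consisting of the powers of `X` in decreasing order, so that
multiplication by `X` becomes a Jordan block. -/
noncomputable def adjoinRootXPowBasis (K : Type*) [Field K] (s : ℕ) :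
    Basis (Fin s) K (AdjoinRoot (X ^ s : K[X])) :=
  ((AdjoinRoot.powerBasis' (monic_X_pow (R := K) s)).basis.reindex
    (finCongr ((AdjoinRoot.powerBasis'_dim _).trans (natDegree_X_pow s)))).reindex Fin.revPerm

theorem adjoinRootXPowBasis_apply (s : ℕ) (j : Fin s) :
    adjoinRootXPowBasis K s j = AdjoinRoot.root _ ^ (s - 1 - (j : ℕ)) := by
  rw [adjoinRootXPowBasis, Basis.reindex_apply, Basis.reindex_apply, PowerBasis.basis_eq_pow,
    AdjoinRoot.powerBasis'_gen, Nat.sub_right_comm, Nat.sub_sub]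
  rfl

/-- `adjoinRootXPowBasis` for the syntactic form of `K[X] / (X ^ s)` that occurs in the structure
theorem for torsion modules over a principal ideal domain. -/
noncomputable def quotXPowBasis (K : Type*) [Field K] (s : ℕ) :
    Basis (Fin s) K (K[X] ⧸ (K[X] ∙ (X ^ s : K[X]))) :=
  adjoinRootXPowBasis K s

theorem quotXPowBasis_apply (s : ℕ) (j : Fin s) :
    quotXPowBasis K s j = Submodule.Quotient.mk (X ^ (s - 1 - (j : ℕ))) :=
  adjoinRootXPowBasis_apply s j

theorem X_smul_quotXPowBasis (s : ℕ) (j : Fin s) :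
    (X : K[X]) • quotXPowBasis K s j =
      if h : 0 < (j : ℕ) then quotXPowBasis K s ⟨j - 1, by omega⟩ else 0 := by
  rw [quotXPowBasis_apply, ← Submodule.Quotient.mk_smul, smul_eq_mul, ← pow_succ']
  split_ifs with h
  · rw [quotXPowBasis_apply, show s - 1 - (j : ℕ) + 1 = s - 1 - (j - 1) by omega]
  · rw [Submodule.Quotient.mk_eq_zero, show s - 1 - (j : ℕ) + 1 = s by omega]
    exact Submodule.mem_span_singleton_self _

theorem toMatrix_lsmul_X_quotXPowBasis (s : ℕ) :
    LinearMap.toMatrix (quotXPowBasis K s) (quotXPowBasis K s) (Algebra.lsmul K K _ (X : K[X])) =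
      jordanBlock 0 s := by
  ext x y
  rw [LinearMap.toMatrix_apply, jordanBlock_zero_apply, Algebra.lsmul_coe]
  beta_reduce
  rw [X_smul_quotXPowBasis]
  split_ifs with hy hxy hxy
  · rw [Basis.repr_self, Finsupp.single_apply, if_pos (Fin.ext (by simp only; omega))]
  · rw [Basis.repr_self, Finsupp.single_apply,
      if_neg fun h => hxy (by have := Fin.ext_iff.1 h; simp only at this; omega)]
  · omega
  · simp

theorem dfinsuppBasis_apply {κ : Type*} [DecidableEq κ] {M : κ → Type*} [∀ i, AddCommGroup (M i)]
    [∀ i, Module K (M i)] {η : κ → Type*} (b : ∀ i, Basis (η i) K (M i)) (i : κ) (j : η i) :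
    DFinsupp.basis b ⟨i, j⟩ = DFinsupp.single i (b i j) := by
  classical
  rw [Basis.apply_eq_iff]
  simp [DFinsupp.basis, DFinsupp.mapRange_single, Equiv.symm_apply_eq,
    sigmaFinsuppEquivDFinsupp_single]

theorem toMatrix_dfinsuppBasis_mapRange {κ : Type*} [Fintype κ] [DecidableEq κ] {M : κ → Type*}
    [∀ i, AddCommGroup (M i)] [∀ i, Module K (M i)] {η : κ → Type*} [∀ i, Fintype (η i)]
    [∀ i, DecidableEq (η i)] (b : ∀ i, Basis (η i) K (M i)) (f : ∀ i, M i →ₗ[K] M i) :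
    LinearMap.toMatrix (DFinsupp.basis b) (DFinsupp.basis b) (DFinsupp.mapRange.linearMap f) =
      Matrix.blockDiagonal' fun i => LinearMap.toMatrix (b i) (b i) (f i) := by
  ext ⟨i, x⟩ ⟨j, y⟩
  rw [LinearMap.toMatrix_apply, dfinsuppBasis_apply, DFinsupp.mapRange.linearMap_apply,
    DFinsupp.mapRange_single]
  by_cases hij : i = j
  · subst hij
    simp [DFinsupp.basis, LinearMap.toMatrix_apply]
  · rw [Matrix.blockDiagonal'_apply_ne _ _ _ hij]
    simp [DFinsupp.basis, DFinsupp.single_apply, Ne.symm hij]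

theorem exists_basis_toMatrix_eq_blockDiagonal'_jordanBlock {V : Type*} [AddCommGroup V]
    [Module K V] [FiniteDimensional K V] {f : End K V} (hf : IsNilpotent f) :
    ∃ (d : ℕ) (k : Fin d → ℕ) (B : Basis (Σ i, Fin (k i)) K V),
      LinearMap.toMatrix B B f = Matrix.blockDiagonal' fun i => jordanBlock 0 (k i) := by
  obtain ⟨N, hN⟩ := hf
  have htorsion : IsTorsion' (AEval' f) (Submonoid.powers (X : K[X])) := by
    refine (Submodule.isTorsion'_powers_iff _).2 fun x => ⟨N, ?_⟩
    obtain ⟨v, rfl⟩ := (AEval'.of f).surjective x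
    rw [AEval'.X_pow_smul_of, hN, zero_smul, map_zero]
  obtain ⟨d, k, ⟨e⟩⟩ := torsion_by_prime_power_decomposition (irreducible_X (R := K)) htorsion
  let φ := (e.restrictScalars K).symm.trans (AEval'.of f).symm
  let b := DFinsupp.basis fun i => quotXPowBasis K (k i)
  have hφ : ∀ z, f (φ z) = φ ((X : K[X]) • z) := fun z =>
    (AEval'.of_symm_X_smul f _).symm.trans (congrArg (AEval'.of f).symm (map_smul e.symm X z).symm)
  refine ⟨d, k, b.map φ, ?_⟩
  simp only [← toMatrix_lsmul_X_quotXPowBasis, ← toMatrix_dfinsuppBasis_mapRange]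
  ext x y
  rw [LinearMap.toMatrix_apply, LinearMap.toMatrix_apply, Basis.map_apply, hφ]
  exact congrArg (fun z => b.repr z x) (φ.symm_apply_apply _)

theorem blockDiagonal'_submatrix_sigmaMap {κ κ' : Type*} [DecidableEq κ] [DecidableEq κ']
    {m : κ → Type*} (A : ∀ i, Matrix (m i) (m i) K) {g : κ' → κ} (hg : Function.Injective g) :
    (Matrix.blockDiagonal' A).submatrix (Sigma.map g fun _ => id) (Sigma.map g fun _ => id) =
      Matrix.blockDiagonal' fun i => A (g i) := by
  ext ⟨i, x⟩ ⟨j, y⟩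
  by_cases hij : i = j
  · subst hij
    simp [Sigma.map]
  · simp [Sigma.map, Matrix.blockDiagonal'_apply_ne _ _ _ hij,
      Matrix.blockDiagonal'_apply_ne _ _ _ (hg.ne hij)]

theorem exists_isJordanForm_of_conj_eq {ι : Type*} [Fintype ι] [DecidableEq ι]
    {A : Matrix ι ι K} {d : ℕ} (b : Fin d → K × ℕ) (e : ι ≃ Σ i, Fin (b i).2) (P : (Matrix ι ι K)ˣ)
    (hP : P * A * (P⁻¹ : (Matrix ι ι K)ˣ) =
      (Matrix.blockDiagonal' fun i => jordanBlock (b i).1 (b i).2).submatrix e e) :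
    ∃ S, IsJordanForm A S := by
  let c : Fin (Fintype.card {i // 0 < (b i).2}) ≃ {i // 0 < (b i).2} := (Fintype.equivFin _).symm
  have hc : Function.Injective fun a => (c a : Fin d) := Subtype.val_injective.comp c.injective
  let g : (Σ a, Fin (b (c a)).2) → Σ i, Fin (b i).2 :=
    Sigma.map (fun a => (c a : Fin d)) fun _ => id
  have hg : Function.Bijective g := by
    refine ⟨hc.sigma_map fun _ => Function.injective_id, fun ⟨i, j⟩ => ?_⟩
    obtain ⟨a, ha⟩ := c.surjective ⟨i, j.pos⟩
    obtain rfl : (c a : Fin d) = i := congrArg Subtype.val ha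
    exact ⟨⟨a, j⟩, rfl⟩
  refine ⟨_, _, fun a => b (c a), rfl, fun a => (c a).2,
    e.trans (Equiv.ofBijective g hg).symm, P, ?_⟩
  rw [hP]
  refine Eq.trans ?_ (congrArg (Matrix.submatrix · _ _)
    (blockDiagonal'_submatrix_sigmaMap (fun i => jordanBlock (b i).1 (b i).2) hc))
  have hge : (g ∘ (e.trans (Equiv.ofBijective g hg).symm)) = e :=
    funext fun x => (Equiv.ofBijective g hg).apply_symm_apply (e x)
  rw [Matrix.submatrix_submatrix, hge]

theorem exists_isJordanForm {ι : Type*} [Fintype ι] [DecidableEq ι] {A : Matrix ι ι K} {a : K}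
    (hA : IsNilpotent (A - a • (1 : Matrix ι ι K))) : ∃ S, IsJordanForm A S := by
  obtain ⟨d, k, B, hB⟩ := exists_basis_toMatrix_eq_blockDiagonal'_jordanBlock
    (hA.map (Matrix.toLinAlgEquiv' (R := K)))
  let e : ι ≃ Σ i, Fin (k i) := (Pi.basisFun K ι).indexEquiv B
  let B' : Basis ι K (ι → K) := B.reindex e.symm
  let P : (Matrix ι ι K)ˣ :=
    ⟨B'.toMatrix (Pi.basisFun K ι), (Pi.basisFun K ι).toMatrix B',
      B'.toMatrix_mul_toMatrix_flip _, (Pi.basisFun K ι).toMatrix_mul_toMatrix_flip _⟩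
  have hconj : P * (A - a • 1) * (P⁻¹ : (Matrix ι ι K)ˣ) =
      (Matrix.blockDiagonal' fun i => jordanBlock (0 : K) (k i)).submatrix e e := by
    calc P * (A - a • 1) * (P⁻¹ : (Matrix ι ι K)ˣ)
        = LinearMap.toMatrix B' B' (Matrix.toLin' (A - a • 1)) := by
          rw [← basis_toMatrix_mul_linearMap_toMatrix_mul_basis_toMatrix B' (Pi.basisFun K ι) B'
            (Pi.basisFun K ι), LinearMap.toMatrix_eq_toMatrix', LinearMap.toMatrix'_toLin']
          rfl
      _ = (LinearMap.toMatrix B B (Matrix.toLinAlgEquiv' (A - a • 1))).submatrix e e := by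
          ext x y
          simp only [B', LinearMap.toMatrix_apply, Basis.reindex_apply, Basis.repr_reindex_apply,
            Equiv.symm_symm, Matrix.submatrix_apply]
          rfl
      _ = _ := by rw [hB]
  have hblocks : (Matrix.blockDiagonal' fun i => jordanBlock a (k i)) =
      (Matrix.blockDiagonal' fun i => jordanBlock (0 : K) (k i)) + a • 1 := by
    rw [← Matrix.blockDiagonal'_one, ← Matrix.blockDiagonal'_smul, ← Matrix.blockDiagonal'_add]
    exact congrArg _ (funext fun i => jordanBlock_eq_add_smul_one a (k i))
  refine exists_isJordanForm_of_conj_eq (fun i => (a, k i)) e P ?_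
  rw [hblocks, Matrix.submatrix_add, Pi.add_apply, Pi.add_apply, ← hconj, Matrix.submatrix_smul]
  simp [mul_sub, sub_mul, -Matrix.coe_units_inv]

end Existence

section Sl2

variable {R V : Type*} [Ring R] [AddCommGroup V] [Module R V] {E F H : R}

theorem smul_smul_eq_of_lie_eq {d w : ℤ} {v : V} (hHE : ⁅H, E⁆ = d • E) (hv : H • v = w • v) :
    H • E • v = (w + d) • E • v := by
  have hcomm : H * E = E * H + d • E := by rw [← hHE, Ring.lie_def, add_sub_cancel]
  rw [← mul_smul, hcomm, add_smul, mul_smul, hv, smul_comm, add_smul, smul_assoc]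

theorem smul_pow_smul_eq {w : ℤ} {v : V} (hHE : ⁅H, E⁆ = (2 : ℤ) • E) (hv : H • v = w • v)
    (m : ℕ) : H • E ^ m • v = (w + 2 * m) • E ^ m • v := by
  induction m with
  | zero => simpa using hv
  | succ m ih =>
    rw [pow_succ', mul_smul, smul_smul_eq_of_lie_eq hHE ih]
    push_cast
    ring_nf

theorem pow_succ_smul_smul_eq {w : ℤ} {v : V} (hHE : ⁅H, E⁆ = (2 : ℤ) • E) (hEF : ⁅E, F⁆ = H)
    (hv : H • v = w • v) (m : ℕ) :
    E ^ (m + 1) • F • v = F • E ^ (m + 1) • v + ((m + 1) * (w + m)) • E ^ m • v := by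
  have hcomm : ∀ u : V, E • F • u = F • E • u + H • u := fun u => by
    rw [← hEF, Ring.lie_def, sub_smul, mul_smul, mul_smul, add_sub_cancel]
  induction m with
  | zero => simp [hcomm, hv]
  | succ m ih =>
    have hE : ∀ (k : ℕ) (u : V), E • E ^ k • u = E ^ (k + 1) • u := fun k u => by
      rw [pow_succ', mul_smul]
    rw [← hE, ih, smul_add, hcomm, smul_pow_smul_eq hHE hv, hE, smul_comm E, hE, add_assoc,
      ← add_smul]
    push_cast
    ring_nf

theorem eq_zero_of_pow_smul_eq_zero [IsAddTorsionFree V] (hHE : ⁅H, E⁆ = (2 : ℤ) • E)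
    (hHF : ⁅H, F⁆ = (-2 : ℤ) • F) (hEF : ⁅E, F⁆ = H) (hF : IsNilpotent F) {w : ℤ} {v : V}
    (hv : H • v = w • v) {m : ℕ} (hwm : w + m ≤ 0) (hEv : E ^ m • v = 0) : v = 0 := by
  obtain ⟨j, hj⟩ := hF
  have hFv : F ^ j • v = 0 := by rw [hj, zero_smul]
  clear hj
  induction j generalizing v w m with
  | zero => simpa using hFv
  | succ j ih =>
    have hEFv : E ^ (m + 1) • F • v = 0 := by
      rw [pow_succ_smul_smul_eq hHE hEF hv, pow_succ', mul_smul, hEv]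
      simp only [smul_zero, add_zero]
    have hFv' : F • v = 0 := ih (smul_smul_eq_of_lie_eq hHF hv) (by push_cast; omega) hEFv
      (by rwa [← mul_smul, ← pow_succ])
    clear ih hEFv hFv
    induction m with
    | zero => simpa using hEv
    | succ m ihm =>
      have hscaled := pow_succ_smul_smul_eq hHE hEF hv m
      rw [hFv', hEv, smul_zero, smul_zero, zero_add] at hscaled
      have hcoeff : ((m : ℤ) + 1) * (w + m) ≠ 0 :=
        mul_ne_zero (by omega) (by push_cast at hwm; omega)
      exact ihm (by push_cast at hwm; omega) ((smul_eq_zero.1 hscaled.symm).resolve_left hcoeff)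

end Sl2

section Weights

variable {K : Type*} [Field K] {ι : Type*} {wt : ι → ℤ} {d d' : ℤ} {G G' : Matrix ι ι K}

/-- `G` is homogeneous of degree `d` for the grading of `ι → K` in which the basis vector at `x` has
weight `wt x`: it raises all weights by `d`. -/
def IsHomogeneous (wt : ι → ℤ) (d : ℤ) (G : Matrix ι ι K) : Prop :=
  ∀ ⦃x y⦄, G x y ≠ 0 → wt x = wt y + d

theorem isHomogeneous_one [DecidableEq ι] (wt : ι → ℤ) : IsHomogeneous wt 0 (1 : Matrix ι ι K) :=
  fun x y h => by
    obtain rfl : x = y := by_contra fun hxy => h (Matrix.one_apply_ne hxy)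
    exact (add_zero _).symm

theorem IsHomogeneous.mul [Fintype ι] (hG : IsHomogeneous wt d G) (hG' : IsHomogeneous wt d' G') :
    IsHomogeneous wt (d + d') (G * G') := fun x y h => by
  obtain ⟨z, -, hz⟩ := Finset.exists_ne_zero_of_sum_ne_zero h
  rw [hG (left_ne_zero_of_mul hz), hG' (right_ne_zero_of_mul hz)]
  ring

theorem IsHomogeneous.pow [Fintype ι] [DecidableEq ι] (hG : IsHomogeneous wt d G) (i : ℕ) :
    IsHomogeneous wt (i * d) (G ^ i) := by
  induction i with
  | zero => simpa using isHomogeneous_one wt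
  | succ i ih =>
    rw [pow_succ]
    convert ih.mul hG using 1
    push_cast
    ring

theorem IsHomogeneous.sum {κ : Type*} {s : Finset κ} {M : κ → Matrix ι ι K}
    (hM : ∀ j ∈ s, IsHomogeneous wt d (M j)) : IsHomogeneous wt d (∑ j ∈ s, M j) :=
  fun x y h => by
    rw [Matrix.sum_apply] at h
    obtain ⟨j, hj, hjxy⟩ := Finset.exists_ne_zero_of_sum_ne_zero h
    exact hM j hj hjxy

theorem IsHomogeneous.neg_weight (hG : IsHomogeneous wt d G) : IsHomogeneous (-wt) (-d) G :=
  fun x y h => by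
    simp only [Pi.neg_apply, hG h]
    ring

theorem IsHomogeneous.isNilpotent [Fintype ι] [DecidableEq ι] (hG : IsHomogeneous wt d G)
    (hd : d ≠ 0) : IsNilpotent G := by
  let N : ℕ := ∑ x, ∑ y, (wt x - wt y).natAbs
  refine ⟨N + 1, Matrix.ext fun x y => by_contra fun hxy => ?_⟩
  have hdeg := hG.pow (N + 1) hxy
  have hle : (wt x - wt y).natAbs ≤ N :=
    (Finset.single_le_sum (f := fun y => (wt x - wt y).natAbs) (fun _ _ => Nat.zero_le _)
      (Finset.mem_univ y)).trans
    (Finset.single_le_sum (f := fun x => ∑ y, (wt x - wt y).natAbs) (fun _ _ => Nat.zero_le _)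
      (Finset.mem_univ x))
  rw [show wt x - wt y = ((N + 1 : ℕ) : ℤ) * d by rw [hdeg]; ring, Int.natAbs_mul,
    Int.natAbs_natCast] at hle
  nlinarith [Int.natAbs_pos.2 hd]

theorem IsHomogeneous.lie_diagonal [Fintype ι] [DecidableEq ι] (hG : IsHomogeneous wt d G) :
    ⁅Matrix.diagonal fun x => (wt x : K), G⁆ = d • G := by
  ext x y
  rw [Ring.lie_def, Matrix.sub_apply, Matrix.diagonal_mul, Matrix.mul_diagonal, Matrix.smul_apply]
  by_cases h : G x y = 0
  · simp only [h, mul_zero, zero_mul, sub_zero, smul_zero]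
  · rw [hG h, zsmul_eq_mul]
    push_cast
    ring

theorem IsHomogeneous.map_spanSubset_le [Fintype ι] (hG : IsHomogeneous wt d G) {s t : Set ι}
    (hst : ∀ x y, wt x = wt y + d → y ∈ s → x ∈ t) :
    (Pi.spanSubset K s).map G.mulVecLin ≤ Pi.spanSubset K t := by
  rintro - ⟨v, hv, rfl⟩
  refine Pi.mem_spanSubset_iff.2 fun x hx => by_contra fun h => ?_
  obtain ⟨y, -, hy⟩ := Finset.exists_ne_zero_of_sum_ne_zero h
  exact right_ne_zero_of_mul hy (Pi.mem_spanSubset_iff.1 hv y fun hys =>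
    hx (hst x y (hG (left_ne_zero_of_mul hy)) hys))

theorem IsHomogeneous.mulVec_indicator [Fintype ι] (hG : IsHomogeneous wt d G) (w : ℤ) (v : ι → K) :
    G *ᵥ {x | wt x = w}.indicator v = {x | wt x = w + d}.indicator (G *ᵥ v) := by
  ext x
  by_cases hx : wt x = w + d
  · rw [Set.indicator_of_mem (s := {x | wt x = w + d}) hx]
    refine Finset.sum_congr rfl fun y _ => ?_
    by_cases hy : wt y = w
    · rw [Set.indicator_of_mem (s := {x | wt x = w}) hy]
    · have hGxy : G x y = 0 := by_contra fun h => hy (add_right_cancel ((hG h).symm.trans hx))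
      simp only [hGxy, zero_mul]
  · rw [Set.indicator_of_notMem (s := {x | wt x = w + d}) hx]
    refine Finset.sum_eq_zero fun y _ => ?_
    by_cases hy : wt y = w
    · have hGxy : G x y = 0 := by_contra fun h => hx ((hG h).trans (congrArg (· + d) hy))
      simp only [hGxy, zero_mul]
    · rw [Set.indicator_of_notMem (s := {x | wt x = w}) hy, mul_zero]

end Weights

section Sl2Pair

variable {K : Type*} [Field K] {ι : Type*} [Fintype ι] [DecidableEq ι] {wt : ι → ℤ}
  {E F : Matrix ι ι K}

/-- `E` and `F` raise and lower weights by `2` and, together with their commutator, the diagonal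
matrix of weights, satisfy the relations of the standard basis of `sl₂`. The relations
`[H, E] = 2E` and `[H, F] = -2F` are encoded by the homogeneity of `E` and `F`. -/
structure IsSl2Pair (wt : ι → ℤ) (E F : Matrix ι ι K) : Prop where
  raising : IsHomogeneous wt 2 E
  lowering : IsHomogeneous wt (-2) F
  lie_eq : ⁅E, F⁆ = Matrix.diagonal fun x => (wt x : K)

theorem ncard_setOf_le {ι : Type*} [Finite ι] (f : ι → ℤ) (m : ℤ) :
    {x | m ≤ f x}.ncard = {x | f x = m}.ncard + {x | m + 1 ≤ f x}.ncard := by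
  rw [← Set.ncard_union_eq (Set.disjoint_left.2 fun x hx hx' => by
    simp only [Set.mem_ofPred_eq] at hx hx'
    omega)]
  congr 1
  ext x
  simp only [Set.mem_ofPred_eq, Set.mem_union]
  omega

theorem finrank_comap_of_le_range {V V' : Type*} [AddCommGroup V] [Module K V]
    [FiniteDimensional K V] [AddCommGroup V'] [Module K V'] (f : V →ₗ[K] V') {W : Submodule K V'}
    (hW : W ≤ LinearMap.range f) :
    finrank K (LinearMap.ker f) + finrank K W = finrank K (W.comap f) := by
  have h := LinearMap.finrank_range_add_finrank_ker (f.domRestrict (W.comap f))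
  rw [LinearMap.range_domRestrict, Submodule.map_comap_eq_of_le hW, LinearMap.ker_domRestrict,
    (Submodule.comapSubtypeEquivOfLe (LinearMap.ker_le_comap f)).finrank_eq] at h
  omega

namespace IsSl2Pair

theorem symm (h : IsSl2Pair wt E F) : IsSl2Pair (-wt) F E where
  raising := by simpa using h.lowering.neg_weight
  lowering := h.raising.neg_weight
  lie_eq := by
    rw [Ring.lie_def, ← neg_sub, ← Ring.lie_def, h.lie_eq, Matrix.diagonal_neg]
    simp only [Pi.neg_apply, Int.cast_neg]

open scoped Matrix.Module in
theorem eq_zero_of_pow_mulVec_eq_zero [CharZero K] (h : IsSl2Pair wt E F) {w : ℤ} {v : ι → K}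
    (hv : v ∈ Pi.spanSubset K {x | wt x = w}) {m : ℕ} (hwm : w + m ≤ 0)
    (hEv : E ^ m *ᵥ v = 0) : v = 0 := by
  have hweight : Matrix.diagonal (fun x => (wt x : K)) *ᵥ v = w • v := by
    ext x
    rw [Matrix.mulVec_diagonal, Pi.smul_apply, zsmul_eq_mul]
    by_cases hx : wt x = w
    · rw [hx]
    · rw [Pi.mem_spanSubset_iff.1 hv x hx, mul_zero, mul_zero]
  exact eq_zero_of_pow_smul_eq_zero h.raising.lie_diagonal h.lowering.lie_diagonal h.lie_eq
    (h.lowering.isNilpotent (by norm_num)) hweight hwm hEv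

theorem finrank_map_pow [CharZero K] (h : IsSl2Pair wt E F) {w : ℤ} {m : ℕ} (hwm : w + m ≤ 0) :
    finrank K ((Pi.spanSubset K {x | wt x = w}).map (E ^ m).mulVecLin) =
      {x | wt x = w}.ncard := by
  have hinj : Function.Injective ((E ^ m).mulVecLin.domRestrict (Pi.spanSubset K {x | wt x = w})) :=
    (injective_iff_map_eq_zero _).2 fun v hv =>
      Subtype.ext (h.eq_zero_of_pow_mulVec_eq_zero v.2 hwm hv)
  rw [← LinearMap.range_domRestrict, LinearMap.finrank_range_of_inj hinj, Pi.dim_spanSubset]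

theorem map_pow_le (h : IsSl2Pair wt E F) (w : ℕ) :
    (Pi.spanSubset K {x | wt x = -w}).map (E ^ w).mulVecLin ≤ Pi.spanSubset K {x | wt x = w} :=
  (h.raising.pow w).map_spanSubset_le fun x y hxy hy => by
    simp only [Set.mem_ofPred_eq] at hy ⊢
    omega

theorem ncard_neg_weight_le [CharZero K] (h : IsSl2Pair wt E F) (w : ℕ) :
    {x | wt x = -w}.ncard ≤ {x | wt x = w}.ncard := by
  rw [← h.finrank_map_pow (m := w) (by omega), ← Pi.dim_spanSubset (R := K)]
  exact Submodule.finrank_mono (h.map_pow_le w)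

theorem ncard_neg_weight [CharZero K] (h : IsSl2Pair wt E F) (w : ℕ) :
    {x | wt x = -w}.ncard = {x | wt x = w}.ncard := by
  refine le_antisymm (h.ncard_neg_weight_le w) ?_
  simpa only [Pi.neg_apply, neg_inj, neg_eq_iff_eq_neg, neg_neg] using h.symm.ncard_neg_weight_le w

theorem map_pow_eq [CharZero K] (h : IsSl2Pair wt E F) (w : ℕ) :
    (Pi.spanSubset K {x | wt x = -w}).map (E ^ w).mulVecLin = Pi.spanSubset K {x | wt x = w} :=
  Submodule.eq_of_le_of_finrank_eq (h.map_pow_le w) (by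
    rw [h.finrank_map_pow (by omega), Pi.dim_spanSubset, h.ncard_neg_weight])

theorem spanSubset_le_range_pow [CharZero K] (h : IsSl2Pair wt E F) (i : ℕ) :
    Pi.spanSubset K {x | (i : ℤ) ≤ wt x} ≤ LinearMap.range (E ^ i).mulVecLin := by
  refine Submodule.span_le.2 ?_
  rintro - ⟨x, hx, rfl⟩
  obtain ⟨j, hj⟩ : ∃ j : ℕ, wt x = (i + j : ℕ) := ⟨(wt x - i).toNat, by grind⟩
  have hmem : Pi.basisFun K ι x ∈ Pi.spanSubset K {y | wt y = (i + j : ℕ)} :=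
    Submodule.subset_span ⟨x, hj, rfl⟩
  rw [← h.map_pow_eq, pow_add, Matrix.mulVecLin_mul, Submodule.map_comp] at hmem
  exact LinearMap.map_le_range hmem

theorem comap_pow_spanSubset [CharZero K] (h : IsSl2Pair wt E F) (i : ℕ) :
    (Pi.spanSubset K {x | (i : ℤ) ≤ wt x}).comap (E ^ i).mulVecLin =
      Pi.spanSubset K {x | -(i : ℤ) ≤ wt x} := by
  have hE := h.raising.pow i
  refine le_antisymm (fun v hv => Pi.mem_spanSubset_iff.2 fun x hx => ?_)
    (Submodule.map_le_iff_le_comap.1 (hE.map_spanSubset_le fun x y hxy hy => ?_))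
  · simp only [Set.mem_ofPred_eq, not_le] at hx
    have hcomponent : {y | wt y = wt x}.indicator v = 0 := by
      refine h.eq_zero_of_pow_mulVec_eq_zero (w := wt x) (m := i)
        (Pi.mem_spanSubset_iff.2 fun y hy => Set.indicator_of_notMem hy v) (by omega) ?_
      rw [hE.mulVec_indicator]
      refine Set.indicator_eq_zero.2 (Set.disjoint_left.2 fun y hy hyx => hy ?_)
      refine Pi.mem_spanSubset_iff.1 hv y fun hiy => ?_
      simp only [Set.mem_ofPred_eq] at hyx hiy
      omega
    simpa using congrFun hcomponent x
  · simp only [Set.mem_ofPred_eq] at hy ⊢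
    omega

theorem rank_pow [CharZero K] (h : IsSl2Pair wt E F) (i : ℕ) :
    (E ^ i).rank = {x | (i : ℤ) ≤ wt x}.ncard + {x | (i : ℤ) + 1 ≤ -wt x}.ncard := by
  have hker := finrank_comap_of_le_range _ (h.spanSubset_le_range_pow i)
  rw [h.comap_pow_spanSubset, Pi.dim_spanSubset, Pi.dim_spanSubset] at hker
  have hcompl := Set.ncard_add_ncard_compl {x | -(i : ℤ) ≤ wt x}
  simp only [Set.compl_ofPred, not_le, lt_neg, ← Int.add_one_le_iff, Nat.card_eq_fintype_card]
    at hcompl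
  have hrank := rank_add_finrank_ker_mulVecLin (E ^ i)
  omega

theorem rank_pow_add_rank_pow [CharZero K] (h : IsSl2Pair wt E F) (s : ℕ) :
    (E ^ s).rank + (E ^ (s + 2)).rank + {x | wt x = s + 2}.ncard =
      2 * (E ^ (s + 1)).rank + {x | wt x = s}.ncard := by
  have hsymm : {x | -wt x = s + 2}.ncard = {x | wt x = s + 2}.ncard := by
    simpa only [neg_eq_iff_eq_neg, Nat.cast_add, Nat.cast_ofNat] using h.ncard_neg_weight (s + 2)
  have hsymm' : {x | -wt x = s + 1}.ncard = {x | wt x = s + 1}.ncard := by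
    simpa only [neg_eq_iff_eq_neg, Nat.cast_add, Nat.cast_one] using h.ncard_neg_weight (s + 1)
  have hpos₀ := ncard_setOf_le wt s
  have hpos₁ := ncard_setOf_le wt (s + 1)
  have hneg₁ := ncard_setOf_le (fun x => -wt x) (s + 1)
  have hneg₂ := ncard_setOf_le (fun x => -wt x) (s + 2)
  have hcast : (s : ℤ) + 1 + 1 = s + 2 := by ring
  simp only [h.rank_pow, Nat.cast_add, Nat.cast_one, Nat.cast_ofNat, hcast]
    at hpos₀ hpos₁ hneg₁ hneg₂ ⊢
  omega

end IsSl2Pair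

end Sl2Pair

section Exponential

theorem exists_isUnit_exp_sub_one_eq_mul {A : Type*} [Ring A] [Algebra ℚ A] {a : A}
    (ha : IsNilpotent a) :
    ∃ u : A, IsUnit u ∧ Commute a u ∧ IsNilpotent.exp a - 1 = a * u := by
  obtain ⟨k, hk⟩ := ha
  let v : A := ∑ i ∈ range k, ((i + 2).factorial : ℚ)⁻¹ • a ^ i
  have hv : Commute a v :=
    Commute.sum_right _ _ _ fun i _ => ((Commute.refl a).pow_right i).smul_right _
  refine ⟨1 + a * v, (hv.isNilpotent_mul_right ⟨k, hk⟩).isUnit_one_add,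
    (Commute.one_right a).add_right ((Commute.refl a).mul_right hv), ?_⟩
  rw [IsNilpotent.exp_eq_sum (k := k + 2) (by rw [pow_add, hk, zero_mul]), sum_range_succ',
    sum_range_succ', mul_add, mul_one, Finset.mul_sum, Finset.mul_sum]
  simp [pow_succ', add_comm _ a]

variable {K : Type*} [Field K]

theorem row_last_eq_zero_of_commute {s : ℕ} {U : Matrix (Fin (s + 1)) (Fin (s + 1)) K}
    (hU : Commute (jordanBlock 0 (s + 1)) U) {y : Fin (s + 1)} (hy : y ≠ Fin.last s) :
    U (Fin.last s) y = 0 := by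
  have hlt : (y : ℕ) + 1 < s + 1 := by have := Fin.val_lt_last hy; omega
  have h := congrFun₂ hU.eq (Fin.last s) ⟨y + 1, hlt⟩
  simpa [jordanBlock_zero_mul_apply, mul_jordanBlock_zero_apply] using h.symm

theorem last_last_ne_zero_of_commute {s : ℕ} {U : Matrix (Fin (s + 1)) (Fin (s + 1)) K}
    (hU : Commute (jordanBlock 0 (s + 1)) U) (hunit : IsUnit U) :
    U (Fin.last s) (Fin.last s) ≠ 0 := fun h => by
  refine ((Matrix.isUnit_iff_isUnit_det U).1 hunit).ne_zero
    (Matrix.det_eq_zero_of_row_eq_zero (Fin.last s) fun y => ?_)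
  by_cases hy : y = Fin.last s
  · rw [hy, h]
  · exact row_last_eq_zero_of_commute hU hy

/-- The matrix whose columns are `M ^ s v, …, M v, v` for the last basis vector `v`. When `v` is a
cyclic vector of the nilpotent matrix `M`, it is a change of basis to the Jordan form of `M`. -/
def cyclicMatrix {s : ℕ} (M : Matrix (Fin (s + 1)) (Fin (s + 1)) K) :
    Matrix (Fin (s + 1)) (Fin (s + 1)) K :=
  Matrix.of fun x y => (M ^ (s - (y : ℕ))) x (Fin.last s)

theorem mul_cyclicMatrix {s : ℕ} {M : Matrix (Fin (s + 1)) (Fin (s + 1)) K}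
    (hM : M ^ (s + 1) = 0) : M * cyclicMatrix M = cyclicMatrix M * jordanBlock 0 (s + 1) := by
  ext x y
  have hcol : (M * cyclicMatrix M) x y = (M ^ (s - (y : ℕ) + 1)) x (Fin.last s) := by
    rw [pow_succ']
    rfl
  rw [hcol, mul_jordanBlock_zero_apply]
  split_ifs with hy
  · exact congrArg (fun i => (M ^ i) x (Fin.last s)) (by simp only; omega)
  · rw [Nat.le_zero.1 (not_lt.1 hy), Nat.sub_zero, hM, Matrix.zero_apply]

theorem isUnit_cyclicMatrix {s : ℕ} {U : Matrix (Fin (s + 1)) (Fin (s + 1)) K}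
    (hU : Commute (jordanBlock 0 (s + 1)) U) (hunit : IsUnit U) :
    IsUnit (cyclicMatrix (jordanBlock 0 (s + 1) * U)) := by
  set Q := cyclicMatrix (jordanBlock 0 (s + 1) * U) with hQ
  have hQ_apply : ∀ x y, Q x y = ∑ z : Fin (s + 1), if (x : ℕ) + (s - y) = z then
      (U ^ (s - (y : ℕ))) z (Fin.last s) else 0 := fun x y => by
    simp only [hQ, cyclicMatrix, Matrix.of_apply, hU.mul_pow, Matrix.mul_apply,
      jordanBlock_zero_pow_apply, ite_mul, one_mul, zero_mul]
  have htriangular : Q.IsUpperTriangular := fun x y hyx => by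
    replace hyx : y < x := hyx
    exact (hQ_apply x y).trans (Finset.sum_eq_zero fun z _ => if_neg (by omega))
  have hdiag : ∀ x, Q x x ≠ 0 := fun x => by
    rw [hQ_apply, Fintype.sum_eq_single (Fin.last s) fun z hz => if_neg fun hxz => hz
      (Fin.ext (by rw [Fin.val_last]; omega)), if_pos (by rw [Fin.val_last]; omega)]
    exact last_last_ne_zero_of_commute (hU.pow_right _) (hunit.pow _)
  rw [Matrix.isUnit_iff_isUnit_det, Matrix.det_of_isUpperTriangular htriangular]
  exact (Finset.prod_ne_zero_iff.2 fun x _ => hdiag x).isUnit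

theorem isConj_jordanBlock_zero_mul {s : ℕ} {U : Matrix (Fin s) (Fin s) K}
    (hU : Commute (jordanBlock (0 : K) s) U) (hunit : IsUnit U) :
    IsConj (jordanBlock (0 : K) s) (jordanBlock (0 : K) s * U) := by
  rcases s with _ | s
  · exact (Subsingleton.elim _ _ : jordanBlock (0 : K) 0 = _) ▸ IsConj.refl _
  have hpow : (jordanBlock (0 : K) (s + 1) * U) ^ (s + 1) = 0 := by
    rw [hU.mul_pow, jordanBlock_zero_pow_eq_zero le_rfl, zero_mul]
  exact ⟨(isUnit_cyclicMatrix hU hunit).unit, (mul_cyclicMatrix hpow).symm⟩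

theorem isConj_jordanBlock_smul_exp [CharZero K] {a : K} (ha : a ≠ 0) (s : ℕ) :
    IsConj (jordanBlock a s) (a • IsNilpotent.exp (jordanBlock (0 : K) s)) := by
  obtain ⟨u, hu, hcomm, hexp⟩ :=
    exists_isUnit_exp_sub_one_eq_mul (isNilpotent_jordanBlock_zero K s)
  obtain ⟨Q, hQ⟩ := isConj_jordanBlock_zero_mul (hcomm.smul_right a) (hu.smul (Units.mk0 a ha))
  have hscalar : SemiconjBy (Q : Matrix (Fin s) (Fin s) K) (a • 1) (a • 1) :=
    (Commute.one_right _).smul_right a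
  refine ⟨Q, ?_⟩
  rw [jordanBlock_eq_add_smul_one, ← sub_add_cancel (IsNilpotent.exp _) 1, hexp, smul_add,
    ← mul_smul_comm]
  exact hQ.add_right hscalar

theorem rank_smul_exp_sub_smul_one_pow [CharZero K] {ι : Type*} [Fintype ι] [DecidableEq ι]
    {L : Matrix ι ι K} (hL : IsNilpotent L) {c : K} (hc : c ≠ 0) (i : ℕ) :
    ((c • IsNilpotent.exp L - c • 1) ^ i).rank = (L ^ i).rank := by
  obtain ⟨u, hu, hcomm, hexp⟩ := exists_isUnit_exp_sub_one_eq_mul hL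
  have hunit : IsUnit ((c • u) ^ i) := (hu.smul (Units.mk0 c hc)).pow i
  rw [← smul_sub, hexp, ← mul_smul_comm, (hcomm.smul_right c).mul_pow,
    Matrix.rank_mul_eq_left_of_isUnit_det _ _ ((Matrix.isUnit_iff_isUnit_det _).1 hunit)]

end Exponential

section SingleBlock

variable (K : Type*) [Field K]

/-- The lowering operator which completes the nilpotent Jordan block `jordanBlock 0 s` to the
irreducible representation of `sl₂` of dimension `s`. -/
def jordanLowering (s : ℕ) : Matrix (Fin s) (Fin s) K :=
  Matrix.of fun x y => if (y : ℕ) + 1 = x then (y + 1 : K) * (s - 1 - y) else 0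

/-- The weight of the basis vector at `x` in the irreducible representation of `sl₂` of dimension
`s`, for which `jordanBlock 0 s` is the raising operator. -/
def jordanWeight (s : ℕ) (x : Fin s) : ℤ := s - 1 - 2 * x

theorem jordanBlock_zero_mul_jordanLowering (s : ℕ) :
    jordanBlock (0 : K) s * jordanLowering K s =
      Matrix.diagonal fun x : Fin s => ((x : ℕ) + 1 : K) * (s - 1 - (x : ℕ)) := by
  ext x y
  rw [jordanBlock_zero_mul_apply]
  split_ifs with hx
  · simp only [jordanLowering, Matrix.of_apply, Matrix.diagonal_apply, add_left_inj,
      ← Fin.ext_iff, eq_comm (a := y)]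
    split_ifs with hxy
    · rw [hxy]
    · rfl
  · have hlast : (s : K) = (x : ℕ) + 1 := by
      rw [← Nat.cast_add_one]
      exact congrArg _ (by omega)
    simp [Matrix.diagonal_apply, hlast]

theorem jordanLowering_mul_jordanBlock_zero (s : ℕ) :
    jordanLowering K s * jordanBlock (0 : K) s =
      Matrix.diagonal fun x : Fin s => ((x : ℕ) : K) * (s - (x : ℕ)) := by
  ext x y
  rw [mul_jordanBlock_zero_apply, Matrix.diagonal_apply]
  split_ifs with hy hxy hxy
  · subst hxy
    rw [jordanLowering, Matrix.of_apply, if_pos (Nat.sub_add_cancel hy), Nat.cast_pred hy]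
    ring
  · exact if_neg fun h => hxy (Fin.ext (by simp only at h; omega))
  · simp [hxy, Nat.le_zero.1 (not_lt.1 hy)]
  · rfl

theorem isSl2Pair_jordanBlock (s : ℕ) :
    IsSl2Pair (jordanWeight s) (jordanBlock (0 : K) s) (jordanLowering K s) where
  raising x y hxy := by
    rw [jordanBlock_zero_apply, ne_eq, ite_eq_right_iff, Classical.not_imp] at hxy
    simp only [jordanWeight, ← hxy.1]
    push_cast
    ring
  lowering x y hxy := by
    rw [jordanLowering, Matrix.of_apply, ne_eq, ite_eq_right_iff, Classical.not_imp] at hxy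
    simp only [jordanWeight, ← hxy.1]
    push_cast
    ring
  lie_eq := by
    rw [Ring.lie_def, jordanBlock_zero_mul_jordanLowering, jordanLowering_mul_jordanBlock_zero,
      Matrix.diagonal_sub]
    congr 1
    ext x
    simp only [jordanWeight]
    push_cast
    ring

end SingleBlock

section Tensor

variable {K : Type*} [Field K] {t : ℕ} {r : Fin t → ℕ}

/-- `tensorMatrix` as a homomorphism of monoids. -/
def tensorMatrixHom : ((j : Fin t) → Matrix (Fin (r j)) (Fin (r j)) K) →*
    Matrix ((j : Fin t) → Fin (r j)) ((j : Fin t) → Fin (r j)) K where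
  toFun := tensorMatrix
  map_one' := by
    ext x y
    simp only [tensorMatrix, Matrix.of_apply, Pi.one_apply, Matrix.one_apply]
    rw [Finset.prod_boole]
    simp only [funext_iff, Finset.mem_univ, forall_const]
  map_mul' A B := by
    ext x y
    simp only [tensorMatrix, Matrix.of_apply, Matrix.mul_apply, Pi.mul_apply,
      ← Finset.prod_mul_distrib, Finset.prod_univ_sum, Fintype.piFinset_univ]

theorem tensorMatrixHom_apply (A : (j : Fin t) → Matrix (Fin (r j)) (Fin (r j)) K) :
    tensorMatrixHom A = tensorMatrix A := rfl

theorem tensorMatrix_smul (c : Fin t → K) (A : (j : Fin t) → Matrix (Fin (r j)) (Fin (r j)) K) :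
    tensorMatrix (fun j => c j • A j) = (∏ j, c j) • tensorMatrix A := by
  ext x y
  simp only [tensorMatrix, Matrix.of_apply, Matrix.smul_apply, smul_eq_mul, Finset.prod_mul_distrib]

theorem tensorMatrix_mulSingle_apply (j : Fin t) (B : Matrix (Fin (r j)) (Fin (r j)) K)
    (x y : (j : Fin t) → Fin (r j)) :
    tensorMatrix (Pi.mulSingle j B) x y = B (x j) (y j) *
      ∏ l ∈ {j}ᶜ, (1 : Matrix (Fin (r l)) (Fin (r l)) K) (x l) (y l) := by
  rw [tensorMatrix, Matrix.of_apply, Fintype.prod_eq_mul_prod_compl j, Pi.mulSingle_eq_same]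
  congr 1
  refine Finset.prod_congr rfl fun l hl => ?_
  rw [Pi.mulSingle_eq_of_ne (by simpa using hl)]

/-- The operator `1 ⊗ ⋯ ⊗ B ⊗ ⋯ ⊗ 1` with `B` in position `j`. -/
def factorMatrix (j : Fin t) : Matrix (Fin (r j)) (Fin (r j)) K →ₐ[K]
    Matrix ((j : Fin t) → Fin (r j)) ((j : Fin t) → Fin (r j)) K :=
  { tensorMatrixHom.comp (MonoidHom.mulSingle _ j) with
    map_zero' := by
      ext x y
      exact (tensorMatrix_mulSingle_apply j 0 x y).trans (zero_mul _)
    map_add' := fun A B => by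
      ext x y
      exact (tensorMatrix_mulSingle_apply j (A + B) x y).trans ((add_mul _ _ _).trans
        (congrArg₂ _ (tensorMatrix_mulSingle_apply j A x y).symm
          (tensorMatrix_mulSingle_apply j B x y).symm))
    commutes' := fun c => by
      rw [Algebra.algebraMap_eq_smul_one, Algebra.algebraMap_eq_smul_one, ← map_one tensorMatrixHom,
        ← Pi.mulSingle_one j]
      ext x y
      exact (tensorMatrix_mulSingle_apply j (c • 1) x y).trans ((smul_mul_assoc c _ _).trans
        (congrArg (c • ·) (tensorMatrix_mulSingle_apply j 1 x y).symm)) }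

theorem factorMatrix_apply (j : Fin t) (B : Matrix (Fin (r j)) (Fin (r j)) K) :
    factorMatrix j B = tensorMatrixHom (Pi.mulSingle j B) := rfl

theorem commute_factorMatrix {j l : Fin t} (hjl : j ≠ l) (A : Matrix (Fin (r j)) (Fin (r j)) K)
    (B : Matrix (Fin (r l)) (Fin (r l)) K) : Commute (factorMatrix j A) (factorMatrix l B) := by
  rw [factorMatrix_apply, factorMatrix_apply]
  exact (Pi.mulSingle_commute hjl A B).map tensorMatrixHom

theorem factorMatrix_apply_ne_zero {j : Fin t} {B : Matrix (Fin (r j)) (Fin (r j)) K}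
    {x y : (j : Fin t) → Fin (r j)} (h : factorMatrix j B x y ≠ 0) :
    B (x j) (y j) ≠ 0 ∧ ∀ l ≠ j, x l = y l := by
  rw [factorMatrix_apply, tensorMatrixHom_apply, tensorMatrix_mulSingle_apply] at h
  refine ⟨left_ne_zero_of_mul h, fun l hl => by_contra fun hxy => ?_⟩
  exact Finset.prod_ne_zero_iff.1 (right_ne_zero_of_mul h) l (by simpa using hl)
    (Matrix.one_apply_ne hxy)

theorem IsHomogeneous.factorMatrix {wt : (j : Fin t) → Fin (r j) → ℤ} {d : ℤ} {j : Fin t}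
    {B : Matrix (Fin (r j)) (Fin (r j)) K} (hB : IsHomogeneous (wt j) d B) :
    IsHomogeneous (fun x => ∑ l, wt l (x l)) d (factorMatrix j B) := fun x y hxy => by
  obtain ⟨hj, hne⟩ := factorMatrix_apply_ne_zero hxy
  beta_reduce
  rw [Fintype.sum_eq_add_sum_compl j, Fintype.sum_eq_add_sum_compl j, hB hj,
    Finset.sum_congr rfl fun l hl => by rw [hne l (by simpa using hl)]]
  ring

theorem factorMatrix_diagonal (j : Fin t) (d : Fin (r j) → K) :
    factorMatrix j (Matrix.diagonal d) = Matrix.diagonal fun x => d (x j) := by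
  ext x y
  by_cases h : x = y
  · subst h
    rw [factorMatrix_apply, tensorMatrixHom_apply, tensorMatrix_mulSingle_apply]
    simp
  · rw [Matrix.diagonal_apply_ne _ h]
    by_contra hne
    obtain ⟨hj, hother⟩ := factorMatrix_apply_ne_zero hne
    refine h (funext fun l => ?_)
    by_cases hl : l = j
    · subst hl
      exact by_contra fun hxy => hj (Matrix.diagonal_apply_ne d hxy)
    · exact hother l hl

theorem lie_sum_sum_of_commute {A κ : Type*} [Ring A] [Fintype κ] {E F : κ → A}
    (h : Pairwise fun j l => Commute (E j) (F l)) : ⁅∑ j, E j, ∑ j, F j⁆ = ∑ j, ⁅E j, F j⁆ := by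
  have hFE : (∑ j, F j) * ∑ j, E j = ∑ j, ∑ l, F l * E j := by
    rw [Finset.sum_mul_sum, Finset.sum_comm]
  rw [Ring.lie_def, Finset.sum_mul_sum, hFE, ← Finset.sum_sub_distrib]
  refine Finset.sum_congr rfl fun j _ => ?_
  rw [← Finset.sum_sub_distrib]
  exact Fintype.sum_eq_single j fun l hl => (h hl.symm).lie_eq

theorem IsSl2Pair.sum_factorMatrix {wt : (j : Fin t) → Fin (r j) → ℤ}
    {E F : (j : Fin t) → Matrix (Fin (r j)) (Fin (r j)) K}
    (h : ∀ j, IsSl2Pair (wt j) (E j) (F j)) :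
    IsSl2Pair (fun x => ∑ j, wt j (x j)) (∑ j, factorMatrix j (E j))
      (∑ j, factorMatrix j (F j)) where
  raising := IsHomogeneous.sum fun j _ => (h j).raising.factorMatrix
  lowering := IsHomogeneous.sum fun j _ => (h j).lowering.factorMatrix
  lie_eq := by
    have hdiag : ∀ j, ⁅factorMatrix j (E j), factorMatrix j (F j)⁆ =
        Matrix.diagonal fun x => (wt j (x j) : K) := fun j => by
      rw [Ring.lie_def, ← map_mul, ← map_mul, ← map_sub, ← Ring.lie_def, (h j).lie_eq,
        factorMatrix_diagonal]
    rw [lie_sum_sum_of_commute fun j l hjl => commute_factorMatrix hjl _ _]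
    simp only [hdiag]
    ext x y
    rw [Matrix.sum_apply]
    by_cases hxy : x = y
    · simp [hxy]
    · simp [hxy]

theorem exp_sum_factorMatrix [CharZero K] {N : (j : Fin t) → Matrix (Fin (r j)) (Fin (r j)) K}
    (hN : ∀ j, IsNilpotent (N j)) :
    IsNilpotent.exp (∑ j, factorMatrix j (N j)) = tensorMatrix fun j => IsNilpotent.exp (N j) := by
  have hnil : ∀ j, IsNilpotent (factorMatrix j (N j)) := fun j => (hN j).map (factorMatrix j)
  have hpartial : ∀ s : Finset (Fin t), IsNilpotent.exp (∑ j ∈ s, factorMatrix j (N j)) =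
      tensorMatrixHom (s.piecewise (fun j => IsNilpotent.exp (N j)) 1) := fun s => by
    induction s using Finset.induction_on with
    | empty => simp [IsNilpotent.exp_zero]
    | insert j s hj ih =>
      have hcomm : ∀ l ∈ s, Commute (factorMatrix j (N j)) (factorMatrix l (N l)) := fun l hl =>
        commute_factorMatrix (ne_of_mem_of_not_mem hl hj).symm _ _
      have hsum : IsNilpotent (∑ l ∈ s, factorMatrix l (N l)) :=
        Commute.isNilpotent_sum (fun l _ => hnil l) fun l m _ _ => by
          obtain rfl | hlm := eq_or_ne l m
          exacts [Commute.refl _, commute_factorMatrix hlm _ _]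
      rw [Finset.sum_insert hj, IsNilpotent.exp_add_of_commute (Commute.sum_right _ _ _ hcomm)
        (hnil j) hsum, ih, ← IsNilpotent.map_exp (hN j), factorMatrix_apply, ← map_mul]
      congr 1
      ext l : 1
      by_cases hl : l = j
      · subst hl
        simp [hj]
      · simp [hl, Finset.piecewise]
  simpa [tensorMatrixHom_apply] using hpartial univ

theorem isConj_tensorMatrix {A B : (j : Fin t) → Matrix (Fin (r j)) (Fin (r j)) K}
    (h : ∀ j, IsConj (A j) (B j)) : IsConj (tensorMatrix A) (tensorMatrix B) := by
  choose Q hQ using h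
  exact tensorMatrixHom.map_isConj ⟨MulEquiv.piUnits.symm Q, funext hQ⟩

end Tensor

section BlockCount

variable {K : Type*} [Field K] {t : ℕ} {r : Fin t → ℕ}

theorem blockCoeff_eq_ncard (r : Fin t → ℕ) (k : ℤ) :
    blockCoeff r k = {x : (j : Fin t) → Fin (r j) | ∑ j, ((x j : ℕ) : ℤ) = k}.ncard := by
  rw [blockCoeff]
  split_ifs with hk
  · simp only [Finset.sum_range, Finset.prod_univ_sum, Fintype.piFinset_univ,
      Finset.prod_pow_eq_pow_sum, finsetSum_coeff, coeff_X_pow, Finset.sum_boole]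
    rw [Set.ncard_eq_toFinset_card', Set.toFinset_ofPred]
    congr 2
    ext x
    simp only [Finset.mem_filter, Finset.mem_univ, true_and, ← Nat.cast_sum]
    omega
  · have hempty : {x : (j : Fin t) → Fin (r j) | ∑ j, ((x j : ℕ) : ℤ) = k} = ∅ :=
      Set.eq_empty_of_forall_notMem fun x hx =>
        hk ((Set.mem_ofPred.1 hx) ▸ Finset.sum_nonneg fun j _ => Int.natCast_nonneg _)
    rw [hempty, Set.ncard_empty, Nat.cast_zero]

/-- The weight of the basis vector at `x` in the tensor product of the irreducible representations
of `sl₂` of dimensions `r j`. -/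
def tensorWeight (r : Fin t → ℕ) (x : (j : Fin t) → Fin (r j)) : ℤ :=
  ∑ j, jordanWeight (r j) (x j)

theorem tensorWeight_eq (x : (j : Fin t) → Fin (r j)) :
    tensorWeight r x = (∑ j, (r j : ℤ)) - t - 2 * ∑ j, ((x j : ℕ) : ℤ) := by
  simp only [tensorWeight, jordanWeight, Finset.sum_sub_distrib, Finset.mul_sum, Finset.sum_const,
    Finset.card_univ, Fintype.card_fin, nsmul_eq_mul, mul_one]

/-- The raising operator `∑ j, 1 ⊗ ⋯ ⊗ J(0, r j) ⊗ ⋯ ⊗ 1` of the tensor product of the irreducible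
representations of `sl₂` of dimensions `r j`. -/
def tensorRaising (K : Type*) [Field K] (r : Fin t → ℕ) :
    Matrix ((j : Fin t) → Fin (r j)) ((j : Fin t) → Fin (r j)) K :=
  ∑ j, factorMatrix j (jordanBlock 0 (r j))

theorem isSl2Pair_tensorRaising (K : Type*) [Field K] (r : Fin t → ℕ) :
    IsSl2Pair (tensorWeight r) (tensorRaising K r)
      (∑ j, factorMatrix j (jordanLowering K (r j))) :=
  IsSl2Pair.sum_factorMatrix fun j => isSl2Pair_jordanBlock K (r j)

theorem isNilpotent_tensorRaising (K : Type*) [Field K] (r : Fin t → ℕ) :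
    IsNilpotent (tensorRaising K r) :=
  (isSl2Pair_tensorRaising K r).raising.isNilpotent two_ne_zero

variable [CharZero K] {α : Fin t → K}

theorem isConj_tensorMatrix_jordanBlock (hα : ∀ j, α j ≠ 0) :
    IsConj (tensorMatrix fun j => jordanBlock (α j) (r j))
      ((∏ j, α j) • IsNilpotent.exp (tensorRaising K r)) := by
  rw [tensorRaising, exp_sum_factorMatrix fun j => isNilpotent_jordanBlock_zero K (r j),
    ← tensorMatrix_smul]
  exact isConj_tensorMatrix fun j => isConj_jordanBlock_smul_exp (hα j) (r j)

theorem rank_tensorMatrix_jordanBlock_sub_pow (hα : ∀ j, α j ≠ 0) (i : ℕ) :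
    ((tensorMatrix (fun j => jordanBlock (α j) (r j)) - (∏ j, α j) • 1) ^ i).rank =
      (tensorRaising K r ^ i).rank := by
  rw [rank_sub_smul_one_pow_eq_of_isConj (isConj_tensorMatrix_jordanBlock hα),
    rank_smul_exp_sub_smul_one_pow (isNilpotent_tensorRaising K r)
      (Finset.prod_ne_zero_iff.2 fun j _ => hα j)]

theorem isNilpotent_tensorMatrix_jordanBlock_sub (hα : ∀ j, α j ≠ 0) :
    IsNilpotent (tensorMatrix (fun j => jordanBlock (α j) (r j)) - (∏ j, α j) • 1) := by
  obtain ⟨i, hi⟩ := isNilpotent_tensorRaising K r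
  refine ⟨i, eq_zero_of_rank_eq_zero ?_⟩
  rw [rank_tensorMatrix_jordanBlock_sub_pow hα, hi, Matrix.rank_zero]

namespace IsJordanForm

variable {S : Multiset (K × ℕ)}

theorem count_tensorMatrix_jordanBlock_add [DecidableEq K]
    (h : IsJordanForm (tensorMatrix fun j => jordanBlock (α j) (r j)) S) (hα : ∀ j, α j ≠ 0)
    (s : ℕ) :
    S.count (∏ j, α j, s + 1) + {x | tensorWeight r x = s + 2}.ncard =
      {x | tensorWeight r x = s}.ncard := by
  have hcount := h.count_add_two_mul_rank (∏ j, α j) s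
  simp only [rank_tensorMatrix_jordanBlock_sub_pow hα] at hcount
  have hrank := (isSl2Pair_tensorRaising K r).rank_pow_add_rank_pow s
  omega

theorem count_tensorMatrix_jordanBlock [DecidableEq K]
    (h : IsJordanForm (tensorMatrix fun j => jordanBlock (α j) (r j)) S) (hα : ∀ j, α j ≠ 0)
    {s : ℕ} {k : ℤ} (hk : (∑ j, (r j : ℤ)) - t = s + 2 * k) :
    S.count (∏ j, α j, s + 1) = blockCoeff r k - blockCoeff r (k - 1) := by
  have hweight : ∀ l : ℤ, {x | tensorWeight r x = s + 2 * l}.ncard = blockCoeff r (k - l) :=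
    fun l => by
      rw [blockCoeff_eq_ncard]
      congr 2
      ext x
      simp only [Set.mem_ofPred_eq, tensorWeight_eq]
      omega
  have hcount := h.count_tensorMatrix_jordanBlock_add hα s
  have h₀ := hweight 0
  have h₁ := hweight 1
  simp only [mul_zero, add_zero, sub_zero, mul_one] at h₀ h₁
  omega

theorem exists_of_mem_tensorMatrix_jordanBlock
    (h : IsJordanForm (tensorMatrix fun j => jordanBlock (α j) (r j)) S) (hα : ∀ j, α j ≠ 0)
    {n : ℕ} (hn : (n : ℤ) = (∑ j, (r j : ℤ)) - t) {q : K × ℕ} (hq : q ∈ S) :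
    ∃ k ≤ n / 2, q = (∏ j, α j, n + 1 - 2 * k) := by
  classical
  obtain ⟨a, s⟩ := q
  obtain rfl : a = ∏ j, α j := h.fst_eq (isNilpotent_tensorMatrix_jordanBlock_sub hα) hq
  obtain ⟨s, rfl⟩ := Nat.exists_eq_add_of_le' (h.snd_pos hq)
  have hcount := h.count_tensorMatrix_jordanBlock_add hα s
  have hpos : 0 < S.count (∏ j, α j, s + 1) := Multiset.count_pos.2 hq
  obtain ⟨x, hx⟩ := Set.nonempty_of_ncard_ne_zero (s := {x | tensorWeight r x = s}) (by omega)
  rw [Set.mem_ofPred_eq, tensorWeight_eq, ← hn, ← Nat.cast_sum] at hx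
  exact ⟨∑ j, (x j : ℕ), by omega, Prod.ext rfl (by simp only; omega)⟩

theorem eq_sum_of_tensorMatrix_jordanBlock
    (h : IsJordanForm (tensorMatrix fun j => jordanBlock (α j) (r j)) S) (hα : ∀ j, α j ≠ 0)
    {n : ℕ} (hn : (n : ℤ) = (∑ j, (r j : ℤ)) - t) :
    S = ∑ k ∈ Finset.range (n / 2 + 1),
      (blockCoeff r k - blockCoeff r ((k : ℤ) - 1)).toNat •
        ({(∏ j, α j, n + 1 - 2 * k)} : Multiset (K × ℕ)) := by
  classical
  let block : ℕ → K × ℕ := fun k => (∏ j, α j, n + 1 - 2 * k)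
  have hmult : ∀ k ∈ range (n / 2 + 1),
      S.count (block k) = (blockCoeff r k - blockCoeff r ((k : ℤ) - 1)).toNat := fun k hk => by
    rw [Finset.mem_range] at hk
    rw [← h.count_tensorMatrix_jordanBlock hα (s := n - 2 * k) (by omega), Int.toNat_natCast]
    exact congrArg (fun s => S.count (∏ j, α j, s)) (by omega)
  have hinj : Set.InjOn block (range (n / 2 + 1)) := fun k hk l hl hkl => by
    simp only [block, Prod.mk.injEq, true_and, coe_range, Set.mem_Iio] at hk hl hkl
    omega
  have hsub : S.toFinset ⊆ (range (n / 2 + 1)).image block := fun q hq => by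
    obtain ⟨k, hk, rfl⟩ :=
      h.exists_of_mem_tensorMatrix_jordanBlock hα hn (Multiset.mem_toFinset.1 hq)
    exact Finset.mem_image_of_mem _ (Finset.mem_range_succ_iff.2 hk)
  calc S = ∑ q ∈ S.toFinset, S.count q • {q} := S.toFinset_sum_count_nsmul_eq.symm
    _ = ∑ q ∈ (range (n / 2 + 1)).image block, S.count q • {q} :=
      Finset.sum_subset hsub fun q _ hq => by
        rw [Multiset.count_eq_zero.2 (mt Multiset.mem_toFinset.2 hq), zero_smul]
    _ = ∑ k ∈ range (n / 2 + 1), S.count (block k) • {block k} := Finset.sum_image hinj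
    _ = _ := Finset.sum_congr rfl fun k hk => by rw [hmult k hk]

end IsJordanForm

end BlockCount

theorem proposition5p4_general {K : Type*} [Field K] [CharZero K] (t : ℕ) (α : Fin t → K)
    (hα : ∀ j, α j ≠ 0) (r : Fin t → ℕ) (n : ℕ) (hn : (n : ℤ) = (∑ j, (r j : ℤ)) - t) :
    (∀ k : ℕ, k ≤ n / 2 → 0 ≤ blockCoeff r k - blockCoeff r ((k : ℤ) - 1)) ∧
    ∀ S : Multiset (K × ℕ),
      IsJordanForm (tensorMatrix fun j => jordanBlock (α j) (r j)) S ↔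
        S = ∑ k ∈ Finset.range (n / 2 + 1),
          (blockCoeff r k - blockCoeff r ((k : ℤ) - 1)).toNat •
            ({(∏ j, α j, n + 1 - 2 * k)} : Multiset (K × ℕ)) := by
  classical
  obtain ⟨T, hT⟩ := exists_isJordanForm (isNilpotent_tensorMatrix_jordanBlock_sub (r := r) hα)
  refine ⟨fun k hk => ?_, fun S => ⟨fun hS => hS.eq_sum_of_tensorMatrix_jordanBlock hα hn, ?_⟩⟩
  · rw [← hT.count_tensorMatrix_jordanBlock hα (s := n - 2 * k) (by omega)]
    exact Int.natCast_nonneg _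
  · rintro rfl
    rwa [← hT.eq_sum_of_tensorMatrix_jordanBlock hα hn]

theorem proposition5p4 {K : Type*} [Field K] [IsAlgClosed K] [CharZero K]
    (t : ℕ) (α : Fin t → K) (hα : ∀ j, α j ≠ 0)
    (r : Fin t → ℕ) (hr : ∀ j, 0 < r j) (hmono : Monotone r)
    (n : ℕ) (hn : (n : ℤ) = (∑ j, (r j : ℤ)) - t) :
    (∀ k : ℕ, k ≤ n / 2 → 0 ≤ blockCoeff r k - blockCoeff r ((k : ℤ) - 1)) ∧
    ∀ S : Multiset (K × ℕ),
      IsJordanForm (tensorMatrix fun j => jordanBlock (α j) (r j)) S ↔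
        S = ∑ k ∈ Finset.range (n / 2 + 1),
          (blockCoeff r k - blockCoeff r ((k : ℤ) - 1)).toNat •
            ({(∏ j, α j, n + 1 - 2 * k)} : Multiset (K × ℕ)) :=
  proposition5p4_general t α hα r n hn
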